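/- Let $(E,d)$ be a complete separable metric space with Borel $\sigma$-algebra $\mathcal B$, let $(\Omega,\mathcal F,P)$ be a probability space with $P$-completion $\bar{\mathcal F}$ of $\mathcal F$, and let $(\vartheta_t)_{t\in\mathbb R}$ be a metric dynamical system on it, i.e. $(t,\omega)\mapsto\vartheta_t\omega$ is measurable, $\vartheta_0=\mathrm{id}$, $\vartheta_{s+t}=\vartheta_s\circ\vartheta_t$, and every $\vartheta_t$ preserves $P$. Let $\varphi$ be a continuous random dynamical system on $E$ over $\vartheta$, i.e. $(t,\omega,x)\mapsto\varphi(t,\omega)x$ is a measurable map $[0,\infty)\times\Omega\times E\to E$ with $\varphi(0,\omega)=\mathrm{id}$ and $\varphi(t+s,\omega)=\varphi(t,\vartheta_s\omega)\circ\varphi(s,\omega)$ for all $s,t\ge 0$ and $\omega\in\Omega$, and every map $\varphi(t,\omega):E\to E$ is continuous. Write $d(A,B)=\sup_{a\in A}\inf_{b\in B}d(a,b)\in[0,\infty]$ for the Hausdorff semi-distance and $A^\delta=\{x\in E: d(\{x\},A)\le\delta\}$ for the closed $\delta$-neighbourhood. A random set is a set $K\subseteq E\times\Omega$ in $\mathcal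 B\otimes\bar{\mathcal F}$, with sections $K(\omega)=\{x:(x,\omega)\in K\}$. It attracts all compact sets if, for every compact $B\subseteq E$, $\lim_{t\to\infty}d(\varphi(t,\vartheta_{-t}\omega)B,K(\omega))=0$ for $P$-almost every $\omega$. A strong $C$-attractor is a random set $A$ such that $A(\omega)$ is compact for all $\omega$, such that $P$-almost surely $\varphi(t,\omega)A(\omega)=A(\vartheta_t\omega)$ for all $t\ge 0$, and which attracts all compact sets. Then the following are equivalent: (i) $\varphi$ has a strong $C$-attractor. (ii) For every $\varepsilon>0$ there is a compact set $C_\varepsilon\subseteq E$ such that for every $\delta>0$ and every compact set $B\subseteq E$ there is $T>0$ with $$P\Big\{\omega:\ \bigcup_{t\ge T}\varphi(t,\vartheta_{-t}\omega)B\subseteq C_\varepsilon^{\delta}\Big\}\ \ge\ 1-\varepsilon .$$ (iii) There is a random set $K\subseteq E\times\Omega$ such that $K(\omega)$ is compact for $P$-almost every $\omega$ and $K$ attracts all compact sets. (The event in (ii) need not belong to $\mathcal F$; $P$ is extended to $\bar{\mathcal F}$ in the usual way.) -/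

import Mathlib

open MeasureTheory Filter Topology Set
open scoped NNReal ENNReal

/-- A metric dynamical system over the probability space `(Ω, P)`: a jointly measurable flow
`(θ_t)` indexed by two-sided time `t ∈ ℝ`, each `θ_t` preserving `P`. -/
structure MetricDynamicalSystem {Ω : Type*} [MeasurableSpace Ω] (P : Measure Ω) where
  /-- The shift `θ_t ω`. -/
  shift : ℝ → Ω → Ω
  measurable_shift : Measurable fun p : ℝ × Ω => shift p.1 p.2
  shift_zero : ∀ ω, shift 0 ω = ω
  shift_add : ∀ s t ω, shift (s + t) ω = shift s (shift t ω)
  measurePreserving_shift : ∀ t, MeasurePreserving (shift t) P P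

/-- A continuous random dynamical system on `E` over the metric dynamical system `θ`: a jointly
measurable cocycle `φ(t, ω) : E → E`, `t ≥ 0`, all of whose maps `φ(t, ω)` are continuous. -/
structure ContinuousRDS {Ω : Type*} [MeasurableSpace Ω] {P : Measure Ω}
    (θ : MetricDynamicalSystem P) (E : Type*) [TopologicalSpace E] [MeasurableSpace E] where
  /-- The map `x ↦ φ(t, ω) x`. -/
  toFun : ℝ≥0 → Ω → E → E
  measurable_toFun : Measurable fun p : ℝ≥0 × Ω × E => toFun p.1 p.2.1 p.2.2
  map_zero : ∀ ω x, toFun 0 ω x = x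
  cocycle : ∀ (t s : ℝ≥0) (ω : Ω) (x : E),
    toFun (t + s) ω x = toFun t (θ.shift (s : ℝ) ω) (toFun s ω x)
  continuous_toFun : ∀ t ω, Continuous (toFun t ω)

/-- The Hausdorff semi-distance `sup_{a ∈ A} inf_{b ∈ B} d(a, b)`, with values in `[0, ∞]`. -/
noncomputable def hausdorffSemidist {E : Type*} [MetricSpace E] (A B : Set E) : ℝ≥0∞ :=
  ⨆ a ∈ A, Metric.infEDist a B

/-- `K : Ω → Set E` is a random set: its graph belongs to the product of the Borel `σ`-algebra of
`E` and the `P`-completion of the `σ`-algebra of `Ω`. -/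
def IsRandomSet {Ω : Type*} [MeasurableSpace Ω] (P : Measure Ω) {E : Type*} [MeasurableSpace E]
    (K : Ω → Set E) : Prop :=
  MeasurableSet {p : E × NullMeasurableSpace Ω P | p.1 ∈ K p.2}

namespace ContinuousRDS

variable {Ω : Type*} [MeasurableSpace Ω] {P : Measure Ω} {θ : MetricDynamicalSystem P}
  {E : Type*} [MetricSpace E] [MeasurableSpace E]

/-- The pullback image `φ(t, θ_{-t} ω) B`. -/
def pullback (φ : ContinuousRDS θ E) (t : ℝ≥0) (ω : Ω) (B : Set E) : Set E :=
  φ.toFun t (θ.shift (-(t : ℝ)) ω) '' B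

/-- `K` attracts all compact sets: for each compact `B`, almost surely
`d(φ(t, θ_{-t} ω) B, K(ω)) → 0` as `t → ∞`. -/
def AttractsCompacts (φ : ContinuousRDS θ E) (K : Ω → Set E) : Prop :=
  ∀ B : Set E, IsCompact B →
    ∀ᵐ ω ∂P, Tendsto (fun t : ℝ≥0 => hausdorffSemidist (φ.pullback t ω B) (K ω)) atTop (𝓝 0)

/-- `A` is a strong (pullback) `C`-attractor: a compact random set which is strictly invariant and
attracts all compact sets. -/
structure IsStrongCAttractor (φ : ContinuousRDS θ E) (A : Ω → Set E) : Prop where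
  isRandomSet : IsRandomSet P A
  isCompact : ∀ ω, IsCompact (A ω)
  invariant : ∀ᵐ ω ∂P, ∀ t : ℝ≥0, φ.toFun t ω '' A ω = A (θ.shift (t : ℝ) ω)
  attracts : φ.AttractsCompacts A

end ContinuousRDS

/-! From an attracting random compact set to concentration: a random compact set lies in a
deterministic compact set up to small probability
(`IsRandomSet.exists_isCompact_measure_not_subset_le`), and attraction then traps late pullback
images near that set.

From concentration to an attractor: take compact sets `D n` increasing in `n` that attract each
given compact set with probability at least `1 - 1/(n+1)`, and let `A` be the union of the pullback
limit sets of the `D m`. Where a compact set attracts `B`, the limit set of `B` attracts `B`, is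
contained in that compact set and is strictly invariant. The crux is compactness of the union.
Almost surely one `D n` attracts every `D m`; by Poincaré recurrence this recurs along the backward
orbit, and pushing forward by invariance puts the limit set of `D m` inside that of `D n`
(`ae_limitSet_subset_limitSet`). So `A` is almost surely a single limit set, and the same argument
shows that it contains the limit set of any compact `B`.

Time is uncountable and paths are only measurable in `t`, so measurability rests on the projection
theorem. -/

namespace MeasureTheory

/-! ### Analytic sets and measurable projection -/

/-- In the Baire space `ℕ → ℕ`, an open set containing the box `{x | ∀ i, x i ≤ n i}` contains a
box given by finitely many of these bounds. -/
theorem exists_finite_box_subset {n : ℕ → ℕ} {U : Set (ℕ → ℕ)} (hU : IsOpen U)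
    (hn : {x : ℕ → ℕ | ∀ i, x i ≤ n i} ⊆ U) : ∃ k, {x : ℕ → ℕ | ∀ i < k, x i ≤ n i} ⊆ U := by
  by_contra! h
  simp only [not_subset] at h
  choose x hx hxU using h
  have hK : IsCompact {x : ℕ → ℕ | ∀ i, x i ≤ n i} := by
    have : {x : ℕ → ℕ | ∀ i, x i ≤ n i} = Set.univ.pi fun i => Iic (n i) := by
      ext; simp [Pi.le_def]
    rw [this]
    exact isCompact_univ_pi fun i => (finite_Iic _).isCompact
  -- Truncating at `n` moves the points into the compact box; each fixed coordinate is eventually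
  -- unaffected.
  obtain ⟨y, hy, ψ, hψ, hlim⟩ := hK.tendsto_subseq (x := fun k i => min (x k i) (n i))
    fun k i => min_le_right _ _
  have hlim' : Tendsto (fun k => x (ψ k)) atTop (𝓝 y) := by
    rw [tendsto_pi_nhds] at hlim ⊢
    intro i
    refine (hlim i).congr' ?_
    filter_upwards [eventually_gt_atTop i] with k hk
    exact min_eq_left (hx (ψ k) i (hk.trans_le (hψ.id_le k)))
  obtain ⟨k, hk⟩ := (hlim'.eventually (hU.mem_nhds (hn hy))).exists
  exact hxU _ hk

/-- Inner regularity of finite measures along analytic sets. -/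
theorem AnalyticSet.exists_isCompact_le_measure {α : Type*} [TopologicalSpace α] [T2Space α]
    [MeasurableSpace α] [OpensMeasurableSpace α] {μ : Measure α} [μ.OuterRegular]
    {A : Set α} (hA : AnalyticSet A) {c : ℝ≥0∞} (hc : c < μ A) :
    ∃ K ⊆ A, IsCompact K ∧ c ≤ μ K := by
  rw [AnalyticSet] at hA
  obtain rfl | ⟨f, hf, rfl⟩ := hA
  · simp at hc
  have step : ∀ (k : ℕ) (S : {S : Set (ℕ → ℕ) // c < μ (f '' S)}),
      ∃ n, c < μ (f '' (S.1 ∩ {x | x k ≤ n})) := by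
    rintro k ⟨S, hS⟩
    -- The images need not be measurable, but continuity from below along monotone unions holds for
    -- arbitrary sets.
    have hu : f '' S = ⋃ n, f '' (S ∩ {x | x k ≤ n}) := by
      rw [← image_iUnion, ← inter_iUnion]
      congr 1
      refine (inter_eq_left.2 fun x _ => mem_iUnion.2 ⟨x k, le_refl (x k)⟩).symm
    rw [hu, Monotone.measure_iUnion] at hS
    · exact lt_iSup_iff.1 hS
    · intro a b hab
      exact image_mono (inter_subset_inter_right _ fun x (hx : x k ≤ a) => hx.trans hab)
  choose g hg using step
  let S : ℕ → {S : Set (ℕ → ℕ) // c < μ (f '' S)} :=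
    Nat.rec ⟨univ, by rwa [image_univ]⟩ fun k S => ⟨_, hg k S⟩
  have hS : ∀ k, (S k).1 = {x | ∀ i < k, x i ≤ g i (S i)} := by
    intro k
    induction k with
    | zero => ext x; simp [S]
    | succ k ih =>
      have : (S (k + 1)).1 = (S k).1 ∩ {x | x k ≤ g k (S k)} := rfl
      rw [this, ih]
      ext x
      simp only [mem_inter_iff, mem_ofPred_eq, Nat.forall_lt_succ_right]
  have hK : IsCompact {x : ℕ → ℕ | ∀ i, x i ≤ g i (S i)} := by
    have : {x : ℕ → ℕ | ∀ i, x i ≤ g i (S i)} = Set.univ.pi fun i => Iic (g i (S i)) := by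
      ext; simp [Pi.le_def]
    rw [this]
    exact isCompact_univ_pi fun i => (finite_Iic _).isCompact
  refine ⟨_, image_subset_range f {x | ∀ i, x i ≤ g i (S i)}, hK.image hf, ?_⟩
  -- The sets `S k` decrease to the box, and an open set around the image of the box already
  -- contains the image of some `S k`, of measure above `c`.
  rw [Set.measure_eq_iInf_isOpen]
  refine le_iInf₂ fun U hKU => le_iInf fun hU => ?_
  obtain ⟨k, hk⟩ := exists_finite_box_subset (hU.preimage hf) (image_subset_iff.1 hKU)
  rw [← hS k] at hk
  exact (S k).2.le.trans (measure_mono (image_subset_iff.2 hk))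

/-- Analytic sets are universally measurable. -/
theorem AnalyticSet.nullMeasurableSet {α : Type*} [TopologicalSpace α] [T2Space α]
    [MeasurableSpace α] [OpensMeasurableSpace α] {μ : Measure α} [IsFiniteMeasure μ]
    [μ.OuterRegular] {A : Set α} (hA : AnalyticSet A) : NullMeasurableSet A μ := by
  by_cases h0 : μ A = 0
  · exact NullMeasurableSet.of_null h0
  obtain ⟨u, -, hu, hlim⟩ := exists_seq_strictMono_tendsto' (pos_iff_ne_zero.2 h0)
  choose K hKA hK hle using fun n => hA.exists_isCompact_le_measure (hu n).2
  have hm : MeasurableSet (⋃ n, K n) := .iUnion fun n => (hK n).measurableSet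
  refine hm.nullMeasurableSet.congr (ae_eq_of_subset_of_measure_ge (iUnion_subset hKA) ?_
    hm.nullMeasurableSet (measure_ne_top _ _))
  exact le_of_tendsto' hlim fun n => (hle n).trans (measure_mono (subset_iUnion _ n))

/-- A measurable set in a product depends on the second coordinate only through countably many
measurable events. -/
theorem exists_measurable_natBool_preimage {X Ω : Type*} [MeasurableSpace X] [MeasurableSpace Ω]
    {S : Set (X × Ω)} (hS : MeasurableSet S) :
    ∃ f : Ω → ℕ → Bool, Measurable f ∧ ∃ S' : Set (X × (ℕ → Bool)), MeasurableSet S' ∧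
      S = {p | (p.1, f p.2) ∈ S'} := by
  classical
  induction S, hS using MeasurableSpace.induction_on_inter generateFrom_prod.symm
    isPiSystem_prod with
  | empty => exact ⟨fun _ _ => true, measurable_const, ∅, .empty, by simp⟩
  | basic t ht =>
    obtain ⟨s, hs, u, hu, rfl⟩ := ht
    refine ⟨fun ω _ => decide (ω ∈ u), ?_, s ×ˢ {y | y 0 = true}, ?_, ?_⟩
    · exact measurable_pi_lambda _ fun _ => measurable_to_bool (by
        simpa [preimage] using hu)
    · exact hs.prod (measurableSet_eq_fun (measurable_pi_apply 0) measurable_const)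
    · ext; simp
  | compl t _ ih =>
    obtain ⟨f, hf, S', hS', rfl⟩ := ih
    exact ⟨f, hf, S'ᶜ, hS'.compl, rfl⟩
  | iUnion t _ _ ih =>
    choose f hf S' hS' h using ih
    refine ⟨fun ω k => f k.unpair.1 ω k.unpair.2, ?_,
      ⋃ n, (fun p : X × (ℕ → Bool) => (p.1, fun j => p.2 (Nat.pair n j))) ⁻¹' S' n, ?_, ?_⟩
    · exact measurable_pi_lambda _ fun k => (measurable_pi_apply _).comp (hf _)
    · refine .iUnion fun n => (measurable_fst.prodMk (measurable_pi_lambda _ fun j => ?_)) (hS' n)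
      exact (measurable_pi_apply _).comp measurable_snd
    · ext p
      simp only [mem_iUnion, mem_preimage, mem_ofPred_eq, Nat.unpair_pair]
      refine exists_congr fun n => ?_
      conv_lhs => rw [h n]
      rfl

/-- **Measurable projection theorem**: the projection of a measurable set along a Polish space is
measurable up to null sets. -/
theorem nullMeasurableSet_image_snd {X Ω : Type*} [TopologicalSpace X] [PolishSpace X]
    [MeasurableSpace X] [BorelSpace X] [MeasurableSpace Ω] (μ : Measure Ω) [IsFiniteMeasure μ]
    {S : Set (X × Ω)} (hS : MeasurableSet S) : NullMeasurableSet (Prod.snd '' S) μ := by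
  -- Coding `Ω` in Cantor space by `f` reduces the claim to an analytic set and the law `μ.map f`.
  obtain ⟨f, hf, S', hS', rfl⟩ := exists_measurable_natBool_preimage hS
  have : Prod.snd '' {p : X × Ω | (p.1, f p.2) ∈ S'} = f ⁻¹' (Prod.snd '' S') := by
    ext ω; simp
  rw [this]
  have : PolishSpace (ℕ → Bool) := {}
  have hA : AnalyticSet (Prod.snd '' S') := hS'.analyticSet.image_of_continuous continuous_snd
  exact (hA.nullMeasurableSet (μ := μ.map f)).preimage (hf.quasiMeasurePreserving μ)

/-- The measurable projection theorem over the completion of a measure space. -/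
theorem nullMeasurableSet_image_snd_completion {X Ω : Type*} [TopologicalSpace X] [PolishSpace X]
    [MeasurableSpace X] [BorelSpace X] [MeasurableSpace Ω] (μ : Measure Ω) [IsFiniteMeasure μ]
    {S : Set (X × NullMeasurableSpace Ω μ)} (hS : MeasurableSet S) :
    NullMeasurableSet (α := Ω) (Prod.snd '' S) μ := by
  have : IsFiniteMeasure μ.completion := ⟨measure_lt_top μ univ⟩
  exact (nullMeasurableSet_image_snd μ.completion hS).measurable_of_complete

end MeasureTheory

theorem hausdorffSemidist_anti_right {E : Type*} [MetricSpace E] (A : Set E) {B C : Set E}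
    (h : B ⊆ C) : hausdorffSemidist A C ≤ hausdorffSemidist A B :=
  iSup₂_mono fun _ _ => Metric.infEDist_anti h

/-! ### Pullback tails and limit sets -/

namespace ContinuousRDS

variable {Ω : Type*} [MeasurableSpace Ω] {P : Measure Ω} {θ : MetricDynamicalSystem P}
  {E : Type*} [MetricSpace E] [MeasurableSpace E]

/-- The union of the pullback images `φ(t, θ_{-t} ω) B` over `t ≥ T`. -/
def tail (φ : ContinuousRDS θ E) (B : Set E) (T : ℝ≥0) (ω : Ω) : Set E :=
  ⋃ t : ℝ≥0, ⋃ _ : T ≤ t, φ.pullback t ω B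

/-- The pullback limit set of `B`. -/
def limitSet (φ : ContinuousRDS θ E) (B : Set E) (ω : Ω) : Set E :=
  ⋂ n : ℕ, closure (φ.tail B n ω)

/-- The pullback images of `B` are eventually contained in every neighbourhood of `C`. -/
def Approaches (φ : ContinuousRDS θ E) (B C : Set E) (ω : Ω) : Prop :=
  ∀ δ : ℝ, 0 < δ → ∃ T : ℝ≥0, φ.tail B T ω ⊆ Metric.cthickening δ C

variable {φ : ContinuousRDS θ E} {B C : Set E} {T : ℝ≥0} {ω : Ω}

theorem mem_tail {y : E} : y ∈ φ.tail B T ω ↔ ∃ t, T ≤ t ∧ y ∈ φ.pullback t ω B := by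
  simp [tail]

theorem pullback_subset_tail {t : ℝ≥0} (h : T ≤ t) : φ.pullback t ω B ⊆ φ.tail B T ω :=
  fun _ hy => mem_tail.2 ⟨t, h, hy⟩

theorem tail_anti {S : ℝ≥0} (h : S ≤ T) : φ.tail B T ω ⊆ φ.tail B S ω := fun y hy => by
  obtain ⟨t, ht, hy⟩ := mem_tail.1 hy
  exact mem_tail.2 ⟨t, h.trans ht, hy⟩

theorem tail_mono (h : B ⊆ C) : φ.tail B T ω ⊆ φ.tail C T ω :=
  iUnion₂_mono fun _ _ => image_mono h

theorem Approaches.mono {B' C' : Set E} (h : φ.Approaches B C ω) (hB : B' ⊆ B) (hC : C ⊆ C') :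
    φ.Approaches B' C' ω := fun δ hδ => by
  obtain ⟨T, hT⟩ := h δ hδ
  exact ⟨T, (tail_mono hB).trans (hT.trans (Metric.cthickening_subset_of_subset δ hC))⟩

theorem approaches_setOf_eq_iInter (φ : ContinuousRDS θ E) (B C : Set E) :
    {ω | φ.Approaches B C ω} = ⋂ k : ℕ, ⋃ n : ℕ,
      {ω | φ.tail B n ω ⊆ Metric.cthickening (1 / ((k : ℝ) + 1)) C} := by
  ext ω
  simp only [mem_iInter, mem_iUnion, mem_ofPred_eq]
  constructor
  · intro h k
    obtain ⟨T, hT⟩ := h _ (Nat.one_div_pos_of_nat (n := k))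
    obtain ⟨n, hn⟩ := exists_nat_ge T
    exact ⟨n, (tail_anti hn).trans hT⟩
  · intro h δ hδ
    obtain ⟨k, hk⟩ := exists_nat_one_div_lt hδ
    obtain ⟨n, hn⟩ := h k
    exact ⟨n, hn.trans (Metric.cthickening_mono hk.le C)⟩

/-! ### Asymptotic compactness -/

/-- Late pullback points are shadowed by points of `C`, so compactness of `C` yields the convergent
subsequence. This drives both attraction and invariance. -/
theorem Approaches.exists_tendsto (h : φ.Approaches B C ω) (hC : IsCompact C) {t : ℕ → ℝ≥0}
    (ht : Tendsto t atTop atTop) {y : ℕ → E} (hy : ∀ k, y k ∈ φ.pullback (t k) ω B) :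
    ∃ z ∈ φ.limitSet B ω, ∃ σ : ℕ → ℕ, Tendsto σ atTop atTop ∧ Tendsto (y ∘ σ) atTop (𝓝 z) := by
  have hnear : ∀ j : ℕ, ∃ k, j ≤ k ∧ ∃ c ∈ C, dist (y k) c < 1 / ((j : ℝ) + 1) := by
    intro j
    have hpos : (0 : ℝ) < 1 / ((j : ℝ) + 1) := Nat.one_div_pos_of_nat
    obtain ⟨T, hT⟩ := h _ (half_pos hpos)
    obtain ⟨k, hk, hjk⟩ := ((ht.eventually_ge_atTop T).and (eventually_ge_atTop j)).exists
    refine ⟨k, hjk, Metric.mem_thickening_iff.1 ?_⟩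
    exact Metric.cthickening_subset_thickening' hpos (half_lt_self hpos) C
      (hT (pullback_subset_tail hk (hy k)))
  choose κ hκ c hc hdist using hnear
  obtain ⟨z, -, ψ, hψ, hz⟩ := hC.tendsto_subseq hc
  have hκ' : Tendsto κ atTop atTop := tendsto_atTop_mono hκ tendsto_id
  have hσ : Tendsto (κ ∘ ψ) atTop atTop := hκ'.comp hψ.tendsto_atTop
  have hlim : Tendsto (y ∘ κ ∘ ψ) atTop (𝓝 z) := by
    refine hz.congr_dist ?_
    refine squeeze_zero (fun _ => dist_nonneg) (fun n => ?_)
      (tendsto_one_div_add_atTop_nhds_zero_nat.comp hψ.tendsto_atTop)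
    rw [dist_comm]
    exact (hdist (ψ n)).le
  refine ⟨z, mem_iInter.2 fun n => mem_closure_of_tendsto hlim ?_, _, hσ, hlim⟩
  filter_upwards [(ht.comp hσ).eventually_ge_atTop (n : ℝ≥0)] with k hk
  exact pullback_subset_tail hk (hy _)

theorem Approaches.limitSet_subset (h : φ.Approaches B C ω) (hC : IsClosed C) :
    φ.limitSet B ω ⊆ C := by
  intro y hy
  rw [← hC.closure_eq, Metric.closure_eq_iInter_cthickening]
  refine mem_iInter₂.2 fun δ hδ => ?_
  obtain ⟨T, hT⟩ := h δ hδ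
  obtain ⟨n, hn⟩ := exists_nat_ge T
  exact closure_minimal ((tail_anti hn).trans hT) Metric.isClosed_cthickening (mem_iInter.1 hy n)

theorem isClosed_limitSet : IsClosed (φ.limitSet B ω) :=
  isClosed_iInter fun _ => isClosed_closure

theorem Approaches.tendsto_hausdorffSemidist (h : φ.Approaches B C ω) (hC : IsCompact C) :
    Tendsto (fun t : ℝ≥0 => hausdorffSemidist (φ.pullback t ω B) (φ.limitSet B ω)) atTop
      (𝓝 0) := by
  rw [ENNReal.tendsto_nhds_zero]
  intro ε hε
  by_contra hcon
  have hex : ∀ n : ℕ, ∃ t : ℝ≥0, (n : ℝ≥0) ≤ t ∧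
      ∃ y ∈ φ.pullback t ω B, ε < Metric.infEDist y (φ.limitSet B ω) := by
    intro n
    obtain ⟨t, ht, hn⟩ := ((not_eventually.1 hcon).and_eventually
      (eventually_ge_atTop (n : ℝ≥0))).exists
    rw [not_le, hausdorffSemidist, lt_iSup_iff] at ht
    obtain ⟨y, hy⟩ := ht
    obtain ⟨hy, hlt⟩ := lt_iSup_iff.1 hy
    exact ⟨t, hn, y, hy, hlt⟩
  choose t ht y hy hlt using hex
  obtain ⟨z, hz, σ, -, hlim⟩ := h.exists_tendsto hC
    (tendsto_atTop_mono ht tendsto_natCast_atTop_atTop) hy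
  have hlim0 := (tendsto_iff_edist_tendsto_0.1 hlim).eventually_lt_const hε
  obtain ⟨k, hk⟩ := hlim0.exists
  exact (hlt (σ k)).not_ge ((Metric.infEDist_le_edist_of_mem hz).trans hk.le)

theorem exists_seq_of_mem_limitSet {y : E} (hy : y ∈ φ.limitSet B ω) (s : ℝ≥0) :
    ∃ t : ℕ → ℝ≥0, (∀ k : ℕ, k + s ≤ t k) ∧
      ∃ x : ℕ → E, (∀ k, x k ∈ φ.pullback (t k) ω B) ∧ Tendsto x atTop (𝓝 y) := by
  have hex : ∀ k : ℕ, ∃ t : ℝ≥0, k + s ≤ t ∧ ∃ x ∈ φ.pullback t ω B,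
      dist x y < 1 / ((k : ℝ) + 1) := by
    intro k
    obtain ⟨n, hn⟩ := exists_nat_ge (k + s)
    obtain ⟨x, hx, hd⟩ := Metric.mem_closure_iff.1 (mem_iInter.1 hy n) _
      (Nat.one_div_pos_of_nat (n := k))
    obtain ⟨t, ht, hx⟩ := mem_tail.1 hx
    exact ⟨t, hn.trans ht, x, hx, by rwa [dist_comm]⟩
  choose t ht x hx hd using hex
  refine ⟨t, ht, x, hx, tendsto_iff_dist_tendsto_zero.2 ?_⟩
  exact squeeze_zero (fun _ => dist_nonneg) (fun k => (hd k).le)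
    tendsto_one_div_add_atTop_nhds_zero_nat

/-! ### Invariance -/

theorem pullback_add_shift (t s : ℝ≥0) (ω : Ω) (B : Set E) :
    φ.pullback (t + s) (θ.shift t ω) B = φ.toFun t ω '' φ.pullback s ω B := by
  have h1 : θ.shift (-((t + s : ℝ≥0) : ℝ)) (θ.shift t ω) = θ.shift (-(s : ℝ)) ω := by
    rw [← θ.shift_add]
    congr 1
    push_cast
    ring
  have h2 : θ.shift (s : ℝ) (θ.shift (-(s : ℝ)) ω) = ω := by
    rw [← θ.shift_add, add_neg_cancel, θ.shift_zero]
  rw [pullback, pullback, h1, image_image]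
  refine image_congr fun x _ => ?_
  rw [φ.cocycle, h2]

theorem image_limitSet_subset (t : ℝ≥0) :
    φ.toFun t ω '' φ.limitSet B ω ⊆ φ.limitSet B (θ.shift t ω) := by
  rintro _ ⟨y, hy, rfl⟩
  refine mem_iInter.2 fun n => ?_
  refine closure_mono ?_ (image_closure_subset_closure_image (φ.continuous_toFun t ω)
    (mem_image_of_mem _ (mem_iInter.1 hy n)))
  rintro _ ⟨x, hx, rfl⟩
  obtain ⟨s, hs, hx⟩ := mem_tail.1 hx
  refine mem_tail.2 ⟨t + s, hs.trans le_add_self, ?_⟩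
  rw [pullback_add_shift]
  exact mem_image_of_mem _ hx

/-- For the inclusion not given by continuity, split the last `t` units of time off the
approximating orbits; the points reached before them accumulate at a preimage, by asymptotic
compactness. -/
theorem Approaches.image_limitSet (h : φ.Approaches B C ω) (hC : IsCompact C) (t : ℝ≥0) :
    φ.toFun t ω '' φ.limitSet B ω = φ.limitSet B (θ.shift t ω) := by
  refine (image_limitSet_subset t).antisymm fun y hy => ?_
  obtain ⟨s, hs, x, hx, hlim⟩ := exists_seq_of_mem_limitSet hy t
  have hx' : ∀ k, ∃ u ∈ φ.pullback (s k - t) ω B, φ.toFun t ω u = x k := by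
    intro k
    have := hx k
    rw [← add_tsub_cancel_of_le (le_add_self.trans (hs k)), pullback_add_shift] at this
    exact this
  choose u hu hux using hx'
  have hs' : Tendsto (fun k => s k - t) atTop atTop :=
    tendsto_atTop_mono (fun k => le_tsub_of_add_le_right (hs k)) tendsto_natCast_atTop_atTop
  obtain ⟨z, hz, σ, hσ, hz'⟩ := h.exists_tendsto hC hs' hu
  refine ⟨z, hz, tendsto_nhds_unique (((φ.continuous_toFun t ω).tendsto z).comp hz') ?_⟩
  refine (hlim.comp hσ).congr fun k => ?_
  exact (hux (σ k)).symm

/-- If the orbit of `ω` backward in time visits infinitely often the points at which `C` attracts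
`B`, then the limit set of `B` is contained in that of `C`. -/
theorem limitSet_subset_limitSet_of_frequently (hC : IsCompact C)
    (h : ∃ᶠ k : ℕ in atTop, φ.Approaches B C (θ.shift (-(k : ℝ)) ω)) :
    φ.limitSet B ω ⊆ φ.limitSet C ω := by
  intro y hy
  refine mem_iInter.2 fun n => subset_closure ?_
  obtain ⟨k, hk, hnk⟩ := (h.and_eventually (eventually_ge_atTop n)).exists
  have hω : θ.shift ((k : ℝ≥0) : ℝ) (θ.shift (-(k : ℝ)) ω) = ω := by
    rw [← θ.shift_add, NNReal.coe_natCast, add_neg_cancel, θ.shift_zero]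
  have him := hk.image_limitSet hC k
  rw [hω] at him
  rw [← him] at hy
  refine mem_tail.2 ⟨k, by exact_mod_cast hnk, ?_⟩
  rw [pullback, NNReal.coe_natCast]
  exact image_mono (hk.limitSet_subset hC.isClosed) hy

/-! ### Measurability -/

section Measurability

variable [CompleteSpace E] [SecondCountableTopology E] [BorelSpace E] [IsProbabilityMeasure P]

/-- The event is the projection to `Ω` of a measurable set of triples (time, initial point, `ω`). -/
theorem nullMeasurableSet_tail_inter_nonempty (φ : ContinuousRDS θ E) {B U : Set E}
    (hB : MeasurableSet B) (hU : MeasurableSet U) (T : ℝ≥0) :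
    NullMeasurableSet {ω | (φ.tail B T ω ∩ U).Nonempty} P := by
  have : PolishSpace (ℝ≥0 × E) := {}
  have hS : MeasurableSet {p : (ℝ≥0 × E) × Ω | (T ≤ p.1.1 ∧ p.1.2 ∈ B) ∧
      φ.toFun p.1.1 (θ.shift (-(p.1.1 : ℝ)) p.2) p.1.2 ∈ U} := by
    have h1 : Measurable fun p : (ℝ≥0 × E) × Ω => θ.shift (-(p.1.1 : ℝ)) p.2 :=
      θ.measurable_shift.comp
        ((measurable_fst.fst.coe_nnreal_real.neg).prodMk measurable_snd)
    have h2 : Measurable fun p : (ℝ≥0 × E) × Ω =>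
        φ.toFun p.1.1 (θ.shift (-(p.1.1 : ℝ)) p.2) p.1.2 :=
      φ.measurable_toFun.comp (measurable_fst.fst.prodMk (h1.prodMk measurable_fst.snd))
    exact ((measurableSet_le measurable_const measurable_fst.fst).inter
      (measurable_fst.snd hB)).inter (h2 hU)
  convert nullMeasurableSet_image_snd P hS using 1
  ext ω
  constructor
  · rintro ⟨y, hy, hyU⟩
    obtain ⟨t, ht, x, hx, rfl⟩ := mem_tail.1 hy
    exact ⟨((t, x), ω), ⟨⟨ht, hx⟩, hyU⟩, rfl⟩
  · rintro ⟨⟨⟨t, x⟩, ω⟩, ⟨⟨ht, hx⟩, hU⟩, rfl⟩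
    exact ⟨_, mem_tail.2 ⟨t, ht, x, hx, rfl⟩, hU⟩

theorem nullMeasurableSet_tail_subset (φ : ContinuousRDS θ E) {B F : Set E}
    (hB : MeasurableSet B) (hF : MeasurableSet F) (T : ℝ≥0) :
    NullMeasurableSet {ω | φ.tail B T ω ⊆ F} P := by
  convert (φ.nullMeasurableSet_tail_inter_nonempty hB hF.compl T).compl using 1
  ext ω
  simp only [mem_ofPred_eq, mem_compl_iff, inter_compl_nonempty_iff, not_not]

/-- Membership in a closure is tested on a countable basis, which leaves countably many hitting
events. -/
theorem isRandomSet_limitSet (φ : ContinuousRDS θ E) {B : Set E} (hB : MeasurableSet B) :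
    IsRandomSet P (φ.limitSet B) := by
  have hb := TopologicalSpace.isBasis_countableBasis E
  have heq : {p : E × NullMeasurableSpace Ω P | p.1 ∈ φ.limitSet B p.2} =
      ⋂ n : ℕ, ⋂ U ∈ TopologicalSpace.countableBasis E, (Prod.fst ⁻¹' Uᶜ ∪
        Prod.snd ⁻¹' {ω : NullMeasurableSpace Ω P | (U ∩ φ.tail B n ω).Nonempty}) := by
    ext ⟨x, ω⟩
    rw [mem_ofPred_eq]
    simp only [limitSet, mem_ofPred_eq, mem_iInter, hb.mem_closure_iff, mem_union, mem_preimage,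
      mem_compl_iff, imp_iff_not_or]
  rw [IsRandomSet, heq]
  refine .iInter fun n => .biInter (TopologicalSpace.countable_countableBasis E) fun U hU => ?_
  have hUm := (hb.isOpen hU).measurableSet
  have hit := φ.nullMeasurableSet_tail_inter_nonempty hB hUm n
  simp only [inter_comm _ U] at hit
  exact (measurable_fst hUm.compl).union (measurable_snd hit)

theorem nullMeasurableSet_approaches (φ : ContinuousRDS θ E) {B : Set E} (hB : MeasurableSet B)
    (C : Set E) : NullMeasurableSet {ω | φ.Approaches B C ω} P := by
  rw [approaches_setOf_eq_iInter]
  exact .iInter fun k => .iUnion fun n =>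
    φ.nullMeasurableSet_tail_subset hB Metric.isClosed_cthickening.measurableSet n

theorem le_measure_approaches (φ : ContinuousRDS θ E) {B C : Set E} (hB : MeasurableSet B)
    {c : ℝ≥0∞} (h : ∀ δ : ℝ, 0 < δ → ∃ T : ℝ≥0,
      c ≤ P {ω | φ.tail B T ω ⊆ Metric.cthickening δ C}) :
    c ≤ P {ω | φ.Approaches B C ω} := by
  rw [approaches_setOf_eq_iInter, Antitone.measure_iInter]
  · refine le_iInf fun k => ?_
    obtain ⟨T, hT⟩ := h _ (Nat.one_div_pos_of_nat (n := k))
    obtain ⟨n, hn⟩ := exists_nat_ge T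
    exact hT.trans (measure_mono fun ω hω => mem_iUnion.2 ⟨n, (tail_anti hn).trans hω⟩)
  · intro k l hkl ω hω
    obtain ⟨n, hn⟩ := mem_iUnion.1 hω
    exact mem_iUnion.2
      ⟨n, Subset.trans hn (Metric.cthickening_mono (Nat.one_div_le_one_div hkl) C)⟩
  · exact fun k => .iUnion fun n =>
      φ.nullMeasurableSet_tail_subset hB Metric.isClosed_cthickening.measurableSet n
  · exact ⟨0, measure_ne_top _ _⟩

/-- Almost surely, if `C` attracts `B` then the limit set of `B` is contained in that of `C`. -/
theorem ae_limitSet_subset_limitSet (φ : ContinuousRDS θ E) {B C : Set E} (hB : MeasurableSet B)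
    (hC : IsCompact C) :
    ∀ᵐ ω ∂P, φ.Approaches B C ω → φ.limitSet B ω ⊆ φ.limitSet C ω := by
  have hit : ∀ (k : ℕ) (ω : Ω), (θ.shift (-1))^[k] ω = θ.shift (-(k : ℝ)) ω := by
    intro k ω
    induction k with
    | zero => simp [θ.shift_zero]
    | succ k ih =>
      rw [Function.iterate_succ_apply', ih, ← θ.shift_add]
      congr 1
      push_cast
      ring
  -- Poincaré recurrence for the time `-1` map, applied to the event that `C` attracts `B`.
  filter_upwards [(θ.measurePreserving_shift (-1)).conservative.ae_mem_imp_frequently_image_mem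
    (φ.nullMeasurableSet_approaches hB C)] with ω hω h
  refine limitSet_subset_limitSet_of_frequently hC ((hω h).mono fun k hk => ?_)
  rw [hit] at hk
  exact hk

end Measurability

end ContinuousRDS

/-! ### Tightness of random compact sets -/

theorem IsRandomSet.nullMeasurableSet_subset {Ω : Type*} [MeasurableSpace Ω] {P : Measure Ω}
    [IsFiniteMeasure P] {E : Type*} [TopologicalSpace E] [PolishSpace E] [MeasurableSpace E]
    [BorelSpace E] {K : Ω → Set E} (hK : IsRandomSet P K) {F : Set E} (hF : MeasurableSet F) :
    NullMeasurableSet {ω | K ω ⊆ F} P := by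
  convert (nullMeasurableSet_image_snd_completion P
    (MeasurableSet.inter hK (measurable_fst hF.compl))).compl using 1
  ext ω
  rw [mem_compl_iff]
  constructor
  · rintro h ⟨⟨x, ω⟩, ⟨hx, hxF⟩, rfl⟩
    exact hxF (h hx)
  · intro h x hx
    by_contra hxF
    exact h ⟨(x, ω), ⟨hx, hxF⟩, rfl⟩

/-- A random set with almost surely compact values is tight. -/
theorem IsRandomSet.exists_isCompact_measure_not_subset_le {Ω : Type*} [MeasurableSpace Ω]
    {P : Measure Ω} [IsFiniteMeasure P] {E : Type*} [MetricSpace E] [CompleteSpace E]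
    [SecondCountableTopology E] [MeasurableSpace E] [BorelSpace E] {K : Ω → Set E}
    (hK : IsRandomSet P K) (hc : ∀ᵐ ω ∂P, IsCompact (K ω)) {ε : ℝ≥0∞} (hε : ε ≠ 0) :
    ∃ C : Set E, IsCompact C ∧ P {ω | ¬ K ω ⊆ C} ≤ ε := by
  rcases isEmpty_or_nonempty E with hE | hE
  · exact ⟨∅, isCompact_empty, by
      simp [eq_empty_of_isEmpty]⟩
  have : PolishSpace E := {}
  obtain ⟨η, hη, hsum⟩ := ENNReal.exists_pos_sum_of_countable' hε ℕ
  -- For each radius `1/(m+1)`, finitely many balls cover `K ω` outside an event of measure `η m`;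
  -- the intersection over `m` is closed and totally bounded.
  let F : ℕ → ℕ → Set E := fun m N =>
    ⋃ n ∈ Iic N, Metric.closedBall (TopologicalSpace.denseSeq E n) (1 / ((m : ℝ) + 1))
  have hFc : ∀ m N, IsClosed (F m N) := fun m N =>
    (finite_Iic N).isClosed_biUnion fun _ _ => Metric.isClosed_closedBall
  have hFm : ∀ m, Monotone (F m) := fun m a b hab =>
    biUnion_subset_biUnion_left (Iic_subset_Iic.2 hab)
  have hnull : ∀ m N, NullMeasurableSet {ω | K ω ⊆ F m N} P := fun m N =>
    hK.nullMeasurableSet_subset (hFc m N).measurableSet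
  have hcover : ∀ m, ∀ᵐ ω ∂P, ∃ N, K ω ⊆ F m N := by
    intro m
    filter_upwards [hc] with ω hω
    have hpos : (0 : ℝ) < 1 / ((m : ℝ) + 1) := Nat.one_div_pos_of_nat
    obtain ⟨N, hN⟩ := hω.elim_directed_cover
      (fun N => ⋃ n ∈ Iic N, Metric.ball (TopologicalSpace.denseSeq E n) (1 / ((m : ℝ) + 1)))
      (fun N => isOpen_biUnion fun _ _ => Metric.isOpen_ball)
      (fun x _ => by
        obtain ⟨n, hn⟩ := (TopologicalSpace.denseRange_denseSeq E).exists_dist_lt x hpos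
        exact mem_iUnion.2 ⟨n, mem_iUnion₂.2 ⟨n, le_refl n, hn⟩⟩)
      (Monotone.directed_le fun a b hab => biUnion_subset_biUnion_left (Iic_subset_Iic.2 hab))
    exact ⟨N, hN.trans (iUnion₂_mono fun _ _ => Metric.ball_subset_closedBall)⟩
  have hsmall : ∀ m, ∃ N, P {ω | ¬ K ω ⊆ F m N} ≤ η m := by
    intro m
    have h0 : P (⋂ N, {ω | ¬ K ω ⊆ F m N}) = 0 := by
      refine measure_mono_null ?_ (hcover m)
      intro ω hω ⟨N, hN⟩
      exact mem_iInter.1 hω N hN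
    have hlim := tendsto_measure_iInter_atTop (μ := P) (s := fun N => {ω | ¬ K ω ⊆ F m N})
      (fun N => (hnull m N).compl)
      (fun a b hab ω hω h => hω (Subset.trans h (hFm m hab))) ⟨0, measure_ne_top _ _⟩
    rw [h0] at hlim
    obtain ⟨N, hN⟩ := (hlim.eventually_le_const (hη m)).exists
    exact ⟨N, hN⟩
  choose N hN using hsmall
  have hclosed : IsClosed (⋂ m, F m (N m)) := isClosed_iInter fun m => hFc m _
  refine ⟨⋂ m, F m (N m), ?_, ?_⟩
  · refine isCompact_iff_totallyBounded_isComplete.2 ⟨?_, hclosed.isComplete⟩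
    refine Metric.totallyBounded_iff.2 fun δ hδ => ?_
    obtain ⟨m, hm⟩ := exists_nat_one_div_lt hδ
    refine ⟨TopologicalSpace.denseSeq E '' Iic (N m), (finite_Iic _).image _, ?_⟩
    rw [biUnion_image]
    exact (iInter_subset _ m).trans
      (iUnion₂_mono fun n _ => Metric.closedBall_subset_ball hm)
  · have hsub : {ω | ¬ K ω ⊆ ⋂ m, F m (N m)} = ⋃ m, {ω | ¬ K ω ⊆ F m (N m)} := by
      ext ω
      simp only [mem_ofPred_eq, mem_iUnion, subset_iInter_iff, not_forall]
    rw [hsub]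
    exact (measure_iUnion_le _).trans ((ENNReal.tsum_le_tsum hN).trans hsum.le)

/-! ### The two main implications -/

namespace ContinuousRDS

variable {Ω : Type*} [MeasurableSpace Ω] {P : Measure Ω} [IsProbabilityMeasure P]
  {θ : MetricDynamicalSystem P} {E : Type*} [MetricSpace E] [CompleteSpace E]
  [SecondCountableTopology E] [MeasurableSpace E] [BorelSpace E]

/-- An attracting random set with compact values forces concentration of the pullback images near
a deterministic compact set. -/
theorem AttractsCompacts.exists_isCompact_tail_subset {φ : ContinuousRDS θ E} {K : Ω → Set E}
    (hK : IsRandomSet P K) (hc : ∀ᵐ ω ∂P, IsCompact (K ω)) (ha : φ.AttractsCompacts K)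
    {ε : ℝ} (hε : 0 < ε) :
    ∃ C : Set E, IsCompact C ∧ ∀ δ : ℝ, 0 < δ → ∀ B : Set E, IsCompact B → ∃ T : ℝ≥0, 0 < T ∧
      ENNReal.ofReal (1 - ε) ≤ P {ω | φ.tail B T ω ⊆ Metric.cthickening δ C} := by
  obtain ⟨C, hC, hPC⟩ := hK.exists_isCompact_measure_not_subset_le hc
    (ENNReal.ofReal_pos.2 (half_pos hε)).ne'
  refine ⟨C, hC, fun δ hδ B hB => ?_⟩
  -- No measurability of `S N` is needed, as the sets increase. Half of `ε` pays for attraction not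
  -- yet achieved, half for `K ω` leaving `C`.
  let S : ℕ → Set Ω := fun N =>
    {ω | ∀ t : ℝ≥0, (N : ℝ≥0) ≤ t → hausdorffSemidist (φ.pullback t ω B) (K ω) ≤ .ofReal δ}
  have hS : Monotone S := fun a b hab ω hω t ht => hω t ((Nat.cast_le.2 hab).trans ht)
  have hS1 : P (⋃ N, S N) = 1 := by
    have hae : ∀ᵐ ω ∂P, ω ∈ ⋃ N, S N := by
      filter_upwards [ha B hB] with ω hω
      obtain ⟨T, hT⟩ := eventually_atTop.1
        (ENNReal.tendsto_nhds_zero.1 hω _ (ENNReal.ofReal_pos.2 hδ))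
      obtain ⟨N, hN⟩ := exists_nat_ge T
      exact mem_iUnion.2 ⟨N, fun t ht => hT t (hN.trans ht)⟩
    have huniv : (⋃ N, S N : Set Ω) =ᵐ[P] univ := eventuallyEq_univ.2 hae
    rw [measure_congr huniv, measure_univ]
  have hex : ∃ N, 0 < N ∧ ENNReal.ofReal (1 - ε / 2) ≤ P (S N) := by
    have hlim := tendsto_measure_iUnion_atTop (μ := P) hS
    rw [hS1] at hlim
    have hlt : ENNReal.ofReal (1 - ε / 2) < 1 := by
      rw [← ENNReal.ofReal_one]
      exact (ENNReal.ofReal_lt_ofReal_iff one_pos).2 (by linarith)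
    obtain ⟨N, hN, hpos⟩ := ((hlim.eventually_const_le hlt).and (eventually_gt_atTop 0)).exists
    exact ⟨N, hpos, hN⟩
  obtain ⟨N, hN, hSN⟩ := hex
  refine ⟨N, Nat.cast_pos.2 hN, ?_⟩
  have hsub : S N ⊆ {ω | φ.tail B N ω ⊆ Metric.cthickening δ C} ∪ {ω | ¬ K ω ⊆ C} := by
    intro ω hω
    by_cases hKC : K ω ⊆ C
    · left
      intro y hy
      obtain ⟨t, ht, hy⟩ := mem_tail.1 hy
      rw [Metric.mem_cthickening_iff]
      exact (Metric.infEDist_anti hKC).trans ((le_iSup₂ (f := fun a _ => Metric.infEDist a (K ω))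
        y hy).trans (hω t ht))
    · exact Or.inr hKC
  have hle := hSN.trans ((measure_mono hsub).trans ((measure_union_le _ _).trans
    (add_le_add_right hPC _)))
  have hsplit : (1 : ℝ) - ε = 1 - ε / 2 - ε / 2 := by ring
  rw [hsplit, ENNReal.ofReal_sub _ (half_pos hε).le]
  exact tsub_le_iff_right.2 hle

theorem exists_isStrongCAttractor (φ : ContinuousRDS θ E)
    (h : ∀ ε : ℝ, 0 < ε → ∃ C : Set E, IsCompact C ∧ ∀ δ : ℝ, 0 < δ → ∀ B : Set E, IsCompact B →
      ∃ T : ℝ≥0, ENNReal.ofReal (1 - ε) ≤ P {ω | φ.tail B T ω ⊆ Metric.cthickening δ C}) :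
    ∃ A : Ω → Set E, φ.IsStrongCAttractor A := by
  classical
  choose C hC hCP using fun n : ℕ => h (1 / ((n : ℝ) + 1)) Nat.one_div_pos_of_nat
  let D : ℕ → Set E := accumulate C
  have hD : ∀ n, IsCompact (D n) := fun n => (finite_Iic n).isCompact_biUnion fun k _ => hC k
  have hDmono : Monotone D := monotone_accumulate
  have hDP : ∀ (n : ℕ) B, IsCompact B →
      ENNReal.ofReal (1 - 1 / ((n : ℝ) + 1)) ≤ P {ω | φ.Approaches B (D n) ω} := by
    intro n B hB
    refine (φ.le_measure_approaches hB.measurableSet fun δ hδ => hCP n δ hδ B hB).trans ?_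
    exact measure_mono fun ω hω => hω.mono Subset.rfl subset_accumulate
  have hone : ∀ G : ℕ → Set Ω, (∀ n, NullMeasurableSet (G n) P) →
      (∀ n : ℕ, ENNReal.ofReal (1 - 1 / ((n : ℝ) + 1)) ≤ P (G n)) → ∀ᵐ ω ∂P, ∃ n, ω ∈ G n := by
    intro G hG hP
    have hlim : Tendsto (fun n : ℕ => ENNReal.ofReal (1 - 1 / ((n : ℝ) + 1))) atTop (𝓝 1) := by
      have := ENNReal.tendsto_ofReal
        ((tendsto_one_div_add_atTop_nhds_zero_nat (𝕜 := ℝ)).const_sub 1)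
      rwa [sub_zero, ENNReal.ofReal_one] at this
    have h1 : P (⋃ n, G n) = 1 := le_antisymm prob_le_one
      (le_of_tendsto' hlim fun n => (hP n).trans (measure_mono (subset_iUnion G n)))
    filter_upwards [(mem_ae_iff_prob_eq_one₀ (.iUnion hG)).2 h1] with ω hω
    exact mem_iUnion.1 hω
  have happ : ∀ B, IsCompact B → ∀ᵐ ω ∂P, ∃ n, φ.Approaches B (D n) ω := fun B hB =>
    hone _ (fun n => φ.nullMeasurableSet_approaches hB.measurableSet (D n)) fun n => hDP n B hB
  -- One `n` serves all `m`: for fixed `n` the events decrease in `m`, so the lower bound on their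
  -- probabilities passes to the intersection.
  have hunif : ∀ᵐ ω ∂P, ∃ n, ω ∈ ⋂ m, {ω | φ.Approaches (D m) (D n) ω} := by
    have hnull : ∀ n m, NullMeasurableSet {ω | φ.Approaches (D m) (D n) ω} P := fun n m =>
      φ.nullMeasurableSet_approaches (hD m).measurableSet (D n)
    refine hone _ (fun n => .iInter (hnull n)) fun n => ?_
    rw [Antitone.measure_iInter _ (hnull n) ⟨0, measure_ne_top _ _⟩]
    · exact le_iInf fun m => hDP n _ (hD m)
    · exact fun a b hab ω hω => hω.mono (hDmono hab) Subset.rfl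
  have hsub : ∀ B, IsCompact B → ∀ᵐ ω ∂P, ∀ n, φ.Approaches B (D n) ω →
      φ.limitSet B ω ⊆ φ.limitSet (D n) ω := fun B hB =>
    ae_all_iff.2 fun n => φ.ae_limitSet_subset_limitSet hB.measurableSet (hD n)
  let A : Ω → Set E := fun ω => ⋃ m, φ.limitSet (D m) ω
  have hAc : ∀ᵐ ω ∂P, IsCompact (A ω) := by
    filter_upwards [hunif, ae_all_iff.2 fun m => hsub (D m) (hD m)] with ω ⟨n, hn⟩ hω
    have hn : ∀ m, φ.Approaches (D m) (D n) ω := fun m => mem_iInter.1 hn m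
    have hA : A ω = φ.limitSet (D n) ω :=
      (iUnion_subset fun m => hω m n (hn m)).antisymm
        (subset_iUnion (fun m => φ.limitSet (D m) ω) n)
    rw [hA]
    exact (hD n).of_isClosed_subset isClosed_limitSet ((hn n).limitSet_subset (hD n).isClosed)
  -- Emptying `A` on the exceptional null set makes every section compact; completeness keeps the
  -- graph measurable.
  refine ⟨fun ω => if IsCompact (A ω) then A ω else ∅, ⟨?_, ?_, ?_, ?_⟩⟩
  · have hN : NullMeasurableSet {ω | IsCompact (A ω)} P :=
      (NullMeasurableSet.of_null hAc : NullMeasurableSet {ω | IsCompact (A ω)}ᶜ P).of_compl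
    have hgraph : MeasurableSet {p : E × NullMeasurableSpace Ω P | p.1 ∈ A p.2} := by
      have : {p : E × NullMeasurableSpace Ω P | p.1 ∈ A p.2} =
          ⋃ m, {p : E × NullMeasurableSpace Ω P | p.1 ∈ φ.limitSet (D m) p.2} := by
        ext p
        rw [mem_ofPred_eq]
        simp only [A, mem_iUnion, mem_ofPred_eq]
      rw [this]
      exact .iUnion fun m => φ.isRandomSet_limitSet (hD m).measurableSet
    have heq : {p : E × NullMeasurableSpace Ω P | p.1 ∈ if IsCompact (A p.2) then A p.2 else ∅} =
        {p : E × NullMeasurableSpace Ω P | p.1 ∈ A p.2} ∩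
          Prod.snd ⁻¹' {ω : NullMeasurableSpace Ω P | IsCompact (A ω)} := by
      ext ⟨x, ω⟩
      rw [mem_ofPred_eq, mem_inter_iff, mem_ofPred_eq, mem_preimage, mem_ofPred_eq]
      by_cases hc : IsCompact (A ω) <;> simp [hc]
    rw [IsRandomSet, heq]
    exact hgraph.inter (measurable_snd hN)
  · intro ω
    split_ifs with hc
    exacts [hc, isCompact_empty]
  -- One null set serves all `t`: invariance of the limit sets is pathwise, and compactness at the
  -- shifted point is inherited from the continuous image.
  · filter_upwards [hAc, hunif] with ω hc ⟨n, hn⟩ t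
    have hinv : φ.toFun t ω '' A ω = A (θ.shift t ω) := by
      simp only [A, image_iUnion]
      exact iUnion_congr fun m =>
        Approaches.image_limitSet (mem_iInter.1 hn m) (hD n) t
    rw [if_pos hc, hinv, if_pos (hinv ▸ hc.image (φ.continuous_toFun t ω))]
  · intro B hB
    filter_upwards [hAc, happ B hB, hsub B hB] with ω hc ⟨n, hn⟩ hω
    rw [if_pos hc]
    refine tendsto_of_tendsto_of_tendsto_of_le_of_le tendsto_const_nhds
      (hn.tendsto_hausdorffSemidist (hD n)) (fun _ => zero_le) fun t => ?_
    exact hausdorffSemidist_anti_right _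
      ((hω n hn).trans (subset_iUnion (fun m => φ.limitSet (D m) ω) n))

end ContinuousRDS

theorem theorem2 {Ω : Type*} [MeasurableSpace Ω] (P : Measure Ω) [IsProbabilityMeasure P]
    (θ : MetricDynamicalSystem P)
    {E : Type*} [MetricSpace E] [CompleteSpace E] [SecondCountableTopology E]
    [MeasurableSpace E] [BorelSpace E] (φ : ContinuousRDS θ E) :
    List.TFAE [
      ∃ A : Ω → Set E, φ.IsStrongCAttractor A,
      ∀ ε : ℝ, 0 < ε → ∃ C : Set E, IsCompact C ∧
        ∀ δ : ℝ, 0 < δ → ∀ B : Set E, IsCompact B → ∃ T : ℝ≥0, 0 < T ∧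
          ENNReal.ofReal (1 - ε) ≤
            P {ω | (⋃ t : ℝ≥0, ⋃ _ : T ≤ t, φ.pullback t ω B) ⊆ Metric.cthickening δ C},
      ∃ K : Ω → Set E, IsRandomSet P K ∧ (∀ᵐ ω ∂P, IsCompact (K ω)) ∧ φ.AttractsCompacts K] := by
  tfae_have 1 → 3 := fun ⟨A, hA⟩ =>
    ⟨A, hA.isRandomSet, ae_of_all _ hA.isCompact, hA.attracts⟩
  tfae_have 3 → 2 := fun ⟨_, hK, hc, ha⟩ _ hε => ha.exists_isCompact_tail_subset hK hc hε
  tfae_have 2 → 1 := fun h => φ.exists_isStrongCAttractor fun ε hε => by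
    obtain ⟨C, hC, hCP⟩ := h ε hε
    refine ⟨C, hC, fun δ hδ B hB => ?_⟩
    obtain ⟨T, -, hT⟩ := hCP δ hδ B hB
    exact ⟨T, hT⟩
  tfae_finish
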